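/- Let $G=(V,E)$ be a finite connected simple graph, let $d\ge 1$ be an integer, and let $f_E:E\to\mathbb{Z}_d$ be an edge labeling with values in the integers modulo $d$. A cycle of $G$ is a closed walk; vertices and edges may repeat. Its consecutive edges are denoted $e_1,\dots,e_k$, and it is called even or odd according to the parity of its length $k$. The pair $(G,f_E)$ is called *compatible* if - (even cycle property) $\sum_{l\text{ odd}}f_E(e_l)\equiv\sum_{l\text{ even}}f_E(e_l)\pmod d$ for every even cycle, and - (odd cycle property) if $d$ is even, $\frac d2\sum_{l=1}^{k}f_E(e_l)\equiv 0\pmod d$ for every odd cycle. It is called *additive* if there is $f_V:V\to\mathbb{Z}_d$ with $f_E(\{u,v\})=f_V(u)+f_V(v)$ for every edge $\{u,v\}\in E$. For a cycle $C$ with edges $e_1,\dots,e_k$ define $\omega_C\in\mathbb{Z}^E$ by $(\omega_C)_e=\sum_{l:\,e_l=e}(-1)^{l-1}$ if $k$ is even, and $(\omega_C)_e=\frac d2\cdot\#\{l:e_l=e\}$ if $k$ is odd and $d$ is even; for $k$ and $d$ both odd, $\omega_C$ is not defined. Let $A_G\in\mathbb{Z}^{V\times E}$ be the ($0/1$, unsigned)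 vertex-edge incidence matrix, $\ker_{\mathbb{Z}}(A_G)=\{x\in\mathbb{Z}^E: A_Gx=0\}$ and $\ker_{\mathbb{Z}_d}(A_G)=\{x\in\mathbb{Z}_d^E: A_Gx\equiv 0 \pmod d\}$. Let $\pi_d:\mathbb{Z}^E\to\mathbb{Z}_d^E$ be coordinatewise reduction, and let $\langle\omega,f_E\rangle=\sum_{e\in E}\omega_e f_E(e)\in\mathbb{Z}_d$ for $\omega\in\mathbb{Z}_d^E$. Then the following statements are equivalent: 1. $(G,f_E)$ is compatible. 2. $\langle\pi_d(\omega_C),f_E\rangle=0$ for every cycle $C$ of $G$ for which $\omega_C$ is defined (every even cycle and, if $d$ is even, every odd cycle). 3. $\langle\omega,f_E\rangle=0$ for every $\omega\in\ker_{\mathbb{Z}_d}(A_G)$. 4. For some finite set $S$ generating the group $\ker_{\mathbb{Z}}(A_G)$, $\langle\pi_d(\omega),f_E\rangle=0$ for all $\omega\in S$; and, if $d$ is even and $G$ has an odd cycle, moreover $\langle\pi_d(\omega_C),f_E\rangle=0$ for some odd cycle $C$. Equivalently, this holds for every choice: for every finite set $S$ generating $\ker_{\mathbb{Z}}(A_G)$,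 $\langle\pi_d(\omega),f_E\rangle=0$ for all $\omega\in S$; and, if $d$ is even, moreover $\langle\pi_d(\omega_C),f_E\rangle=0$ for every odd cycle $C$. 5. $(G,f_E)$ is additive. -/

import Mathlib

namespace ELabel

variable {V : Type*} {G : SimpleGraph V}

/-- The `i`-th edge (counted from `0`) of a walk, as an element of the edge set.

Throughout, a cycle of `G` means a closed walk `c : G.Walk v v`: neither vertices nor edges need be
distinct. (The closed walk of length `0` is harmless: it only contributes conditions `0 = 0`.)
In the usual numbering `e_1, …, e_k` of the edges of a cycle, `edgeAt c i` is `e_{i+1}`. -/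
def edgeAt {u v : V} (c : G.Walk u v) (i : Fin c.length) : G.edgeSet :=
  ⟨s(c.getVert i, c.getVert (i + 1)), c.adj_getVert_succ i.isLt⟩

/-- `G` has an odd cycle. -/
def HasOddCycle (G : SimpleGraph V) : Prop :=
  ∃ (v : V) (c : G.Walk v v), Odd c.length

variable {d : ℕ}

/-- An e-labeling is additive if it has a valid v-labeling. -/
def Additive (f : G.edgeSet → ZMod d) : Prop :=
  ∃ g : V → ZMod d, ∀ (u v : V) (h : G.Adj u v), f ⟨s(u, v), h⟩ = g u + g v

/-- On every even cycle, `∑_{l odd} f(e_l) = ∑_{l even} f(e_l)` (here `l = i + 1`). -/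
def EvenCycleProperty (f : G.edgeSet → ZMod d) : Prop :=
  ∀ (v : V) (c : G.Walk v v), Even c.length →
    ∑ i ∈ Finset.univ.filter (fun i : Fin c.length => Odd (i.val + 1)), f (edgeAt c i) =
      ∑ i ∈ Finset.univ.filter (fun i : Fin c.length => Even (i.val + 1)), f (edgeAt c i)

/-- On every odd cycle, `(d/2) ∑ f(e_l) = 0` modulo `d`. Only used for even `d`. -/
def OddCycleProperty (f : G.edgeSet → ZMod d) : Prop :=
  ∀ (v : V) (c : G.Walk v v), Odd c.length →
    ((d / 2 : ℕ) : ZMod d) * ∑ i : Fin c.length, f (edgeAt c i) = 0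

/-- Compatibility of an e-labeling. -/
def Compatible (f : G.edgeSet → ZMod d) : Prop :=
  (Odd d ∧ EvenCycleProperty f) ∨ (Even d ∧ EvenCycleProperty f ∧ OddCycleProperty f)

/-- The integer vector `ω_C` of a cycle: every occurrence of an edge in the cycle contributes
the alternating sign `+1, -1, +1, …` if the cycle is even, and `d/2` if the cycle is odd.
For odd cycles it is meaningful (and used) only when `d` is even. -/
def omega [DecidableEq V] (d : ℕ) {v : V} (c : G.Walk v v) : G.edgeSet → ℤ := fun e =>
  ∑ i : Fin c.length with edgeAt c i = e,
    if Even c.length then (-1) ^ (i : ℕ) else ((d / 2 : ℕ) : ℤ)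

/-- Coordinatewise reduction modulo `d`. -/
def proj {E : Type*} (d : ℕ) (x : E → ℤ) : E → ZMod d := fun e => (x e : ZMod d)

/-- The integer incidence matrix, with rows the vertices and columns the edges. -/
noncomputable def incidence [DecidableEq V] (G : SimpleGraph V) [DecidableRel G.Adj] :
    Matrix V G.edgeSet ℤ :=
  (G.incMatrix ℤ).submatrix id (fun e : G.edgeSet => (e : Sym2 V))

/-- The kernel over `ℤ` of an integer matrix. -/
def kerInt {m n : Type*} [Fintype n] (A : Matrix m n ℤ) : Submodule ℤ (n → ℤ) :=
  LinearMap.ker A.mulVecLin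

/-- The kernel modulo `d` of an integer matrix. -/
def kerMod {m n : Type*} [Fintype n] (d : ℕ) (A : Matrix m n ℤ) :
    Submodule (ZMod d) (n → ZMod d) :=
  LinearMap.ker (A.map (fun a : ℤ => (a : ZMod d))).mulVecLin

/-- The pairing `⟨ω, f⟩ = ∑_e ω_e f(e)` in `ℤ/d`. -/
def pairing {E : Type*} [Fintype E] (ω f : E → ZMod d) : ZMod d := ∑ e, ω e * f e

end ELabel

namespace ELabel

open Finset

/-! ### Alternating sums along walks and vertex labelings -/

section Walks

variable {V : Type*} {G : SimpleGraph V} {R : Type*} [CommRing R]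

/-! A value `a` at a root `r` propagates along walks; the result is single-valued when closed walks
at `r` have alternating sum `0` (even) or `2a` (odd): `exists_vertex_labeling`. Joining two odd
closed walks gives an even one, so all odd ones at `r` share one sum, and a single one divisible by
2 yields `a`. Divisibility by 2 is automatic for odd `d`; for even `d` it means being killed by
`d/2`, which cannot tell alternating sums from plain sums (`additive_of_altSum`). Conversely, an
additive labeling is a combination of rows of the incidence matrix, so it annihilates the kernel mod
`d`, which contains every `ω_C`. -/

/-- The alternating sum `f(e₁) - f(e₂) + ⋯` of an edge labeling along a walk. -/
def altSum (f : G.edgeSet → R) : {u v : V} → G.Walk u v → R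
  | _, _, .nil => 0
  | _, _, .cons (u := u) (v := v) h p => f ⟨s(u, v), h⟩ - altSum f p

/-- The sum of an edge labeling along a walk. -/
def walkSum (f : G.edgeSet → R) : {u v : V} → G.Walk u v → R
  | _, _, .nil => 0
  | _, _, .cons (u := u) (v := v) h p => f ⟨s(u, v), h⟩ + walkSum f p

theorem altSum_append (f : G.edgeSet → R) {u v w : V} (p : G.Walk u v) (q : G.Walk v w) :
    altSum f (p.append q) = altSum f p + (-1) ^ p.length * altSum f q := by
  induction p with
  | nil => simp [altSum]
  | cons h p ih => simp [altSum, ih, pow_succ]; ring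

theorem altSum_reverse (f : G.edgeSet → R) {u v : V} (p : G.Walk u v) :
    altSum f p.reverse = -((-1) ^ p.length * altSum f p) := by
  induction p with
  | nil => simp [altSum]
  | @cons a b c h p ih =>
    have e : (⟨s(b, a), h.symm⟩ : G.edgeSet) = ⟨s(a, b), h⟩ := Subtype.ext Sym2.eq_swap
    simp [altSum, altSum_append, ih, pow_succ, e]
    ring

theorem sum_pow_mul_edgeAt (f : G.edgeSet → R) {u v : V} (p : G.Walk u v) :
    ∑ i : Fin p.length, (-1) ^ (i : ℕ) * f (edgeAt p i) = altSum f p := by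
  induction p with
  | nil => exact sum_eq_zero fun i _ => i.elim0
  | cons h p ih =>
    rw [altSum, ← ih, sub_eq_add_neg, ← sum_neg_distrib]
    refine (Fin.sum_univ_succ (n := p.length) _).trans ?_
    congr 1
    · simp [edgeAt]
    · refine sum_congr rfl fun i _ => ?_
      have e : edgeAt (.cons h p) (i.succ : Fin (p.length + 1)) = edgeAt p i := rfl
      rw [e, Fin.val_succ, pow_succ]
      ring

theorem sum_edgeAt (f : G.edgeSet → R) {u v : V} (p : G.Walk u v) :
    ∑ i : Fin p.length, f (edgeAt p i) = walkSum f p := by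
  induction p with
  | nil => exact sum_eq_zero fun i _ => i.elim0
  | cons h p ih =>
    rw [walkSum, ← ih]
    refine (Fin.sum_univ_succ (n := p.length) _).trans ?_
    congr 1
    simp [edgeAt]

theorem altSum_of_additive {f : G.edgeSet → R} {g : V → R}
    (hg : ∀ (u v : V) (h : G.Adj u v), f ⟨s(u, v), h⟩ = g u + g v) {u v : V} (p : G.Walk u v) :
    altSum f p = g u - (-1) ^ p.length * g v := by
  induction p with
  | nil => simp [altSum]
  | cons h p ih => simp [altSum, ih, hg, pow_succ]; ring

theorem two_dvd_altSum_sub_walkSum (f : G.edgeSet → R) {u v : V} (p : G.Walk u v) :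
    2 ∣ altSum f p - walkSum f p := by
  induction p with
  | nil => simp [altSum, walkSum]
  | cons h p ih =>
    obtain ⟨s, hs⟩ := ih
    refine ⟨-s - walkSum f p, ?_⟩
    rw [altSum, walkSum]
    linear_combination -hs

/-- If the alternating sums of all even closed walks vanish and the alternating sum of every odd
closed walk at some root is twice a common element, then the labeling comes from the vertices. -/
theorem exists_vertex_labeling (hG : G.Connected) (f : G.edgeSet → R) (r : V) (a : R)
    (heven : ∀ c : G.Walk r r, Even c.length → altSum f c = 0)
    (hodd : ∀ c : G.Walk r r, Odd c.length → altSum f c = 2 * a) :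
    ∃ g : V → R, ∀ (u v : V) (h : G.Adj u v), f ⟨s(u, v), h⟩ = g u + g v := by
  have key : ∀ (v : V) (p q : G.Walk v r),
      altSum f p + (-1) ^ p.length * a = altSum f q + (-1) ^ q.length * a := by
    intro v p q
    -- Going back along `q` and then along `p` is a closed walk at `r`, to which the hypotheses
    -- apply.
    have hc := altSum_append f q.reverse p
    rw [altSum_reverse, SimpleGraph.Walk.length_reverse] at hc
    have hlen : (q.reverse.append p).length = q.length + p.length := by simp
    rcases Nat.even_or_odd (q.length + p.length) with h | h
    · rw [heven _ (hlen ▸ h)] at hc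
      rcases Nat.even_or_odd q.length with hq | hq
      · have hp : Even p.length := (Nat.even_add.1 h).1 hq
        rw [hq.neg_one_pow] at hc ⊢
        rw [hp.neg_one_pow]
        linear_combination -hc
      · have hp : Odd p.length := by
          rw [← Nat.not_even_iff_odd] at hq ⊢
          exact fun hp => hq ((Nat.even_add.1 h).2 hp)
        rw [hq.neg_one_pow] at hc ⊢
        rw [hp.neg_one_pow]
        linear_combination hc
    · rw [hodd _ (hlen ▸ h)] at hc
      rcases Nat.even_or_odd q.length with hq | hq
      · have hp : Odd p.length := (Nat.odd_add'.1 h).2 hq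
        rw [hq.neg_one_pow] at hc ⊢
        rw [hp.neg_one_pow]
        linear_combination -hc
      · have hp : Even p.length := (Nat.odd_add.1 h).1 hq
        rw [hq.neg_one_pow] at hc ⊢
        rw [hp.neg_one_pow]
        linear_combination hc
  have w : ∀ v, G.Walk v r := fun v => (hG.preconnected v r).some
  refine ⟨fun v => altSum f (w v) + (-1) ^ (w v).length * a, fun u v h => ?_⟩
  have := key u (w u) (.cons h (w v))
  simp only [altSum, SimpleGraph.Walk.length_cons, pow_succ] at this
  linear_combination -this

end Walks

section Pairing

variable {V : Type*} {G : SimpleGraph V}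

theorem sum_fiber_edgeAt_mul [Fintype G.edgeSet] [DecidableEq V] {R : Type*} [CommRing R]
    {u v : V} (c : G.Walk u v) (w : Fin c.length → R) (f : G.edgeSet → R) :
    ∑ e, (∑ i : Fin c.length with edgeAt c i = e, w i) * f e = ∑ i, w i * f (edgeAt c i) := by
  rw [← sum_fiberwise (s := univ) (g := fun i => edgeAt c i)]
  refine sum_congr rfl fun e _ => ?_
  rw [sum_mul]
  refine sum_congr rfl fun i hi => ?_
  rw [(mem_filter.1 hi).2]

/-- The ring is general because the identity serves twice: over `ℤ` for kernel membership, over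
`ZMod d` for the pairing. -/
theorem sum_omega_mul_of_even [Fintype G.edgeSet] [DecidableEq V] {R : Type*} [CommRing R]
    (d : ℕ) {v : V} {c : G.Walk v v} (hc : Even c.length) (f : G.edgeSet → R) :
    ∑ e, (omega d c e : R) * f e = altSum f c := by
  rw [← sum_pow_mul_edgeAt, ← sum_fiber_edgeAt_mul]
  simp [omega, hc]

theorem sum_omega_mul_of_odd [Fintype G.edgeSet] [DecidableEq V] {R : Type*} [CommRing R]
    (d : ℕ) {v : V} {c : G.Walk v v} (hc : Odd c.length) (f : G.edgeSet → R) :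
    ∑ e, (omega d c e : R) * f e = ((d / 2 : ℕ) : R) * walkSum f c := by
  rw [← sum_edgeAt, mul_sum, ← sum_fiber_edgeAt_mul]
  simp only [omega, Nat.not_even_iff_odd.2 hc, if_false, Int.cast_sum, Int.cast_natCast]

/-! ### Divisibility by 2 modulo `d`, and additivity -/

variable {d : ℕ}

theorem half_mul_two (hd : Even d) : ((d / 2 : ℕ) : ZMod d) * 2 = 0 := by
  have h := congrArg (Nat.cast : ℕ → ZMod d) (Nat.div_mul_cancel hd.two_dvd)
  simpa using h

theorem half_mul_altSum (hd : Even d) (f : G.edgeSet → ZMod d) {u v : V} (p : G.Walk u v) :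
    ((d / 2 : ℕ) : ZMod d) * altSum f p = ((d / 2 : ℕ) : ZMod d) * walkSum f p := by
  obtain ⟨s, hs⟩ := two_dvd_altSum_sub_walkSum f p
  linear_combination ((d / 2 : ℕ) : ZMod d) * hs + s * half_mul_two hd

/-- With `d = 2m`, `2m ∣ m * x` forces `2 ∣ x`; cancelling `m` needs `d > 0`. -/
theorem two_dvd_of_half_mul_eq_zero (hd0 : 0 < d) (hd : Even d) (x : ZMod d)
    (hx : ((d / 2 : ℕ) : ZMod d) * x = 0) : 2 ∣ x := by
  have : NeZero d := ⟨hd0.ne'⟩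
  obtain ⟨m, rfl⟩ := hd
  rw [← ZMod.natCast_zmod_val x, ← Nat.cast_mul, ZMod.natCast_eq_zero_iff] at hx
  have hm : 0 < m := by omega
  rw [show (m + m) / 2 = m by omega] at hx
  obtain ⟨k, hk⟩ : 2 ∣ x.val := Nat.dvd_of_mul_dvd_mul_left hm (by rwa [mul_two])
  refine ⟨(k : ZMod (m + m)), ?_⟩
  rw [← ZMod.natCast_zmod_val x, hk]
  push_cast
  rfl

theorem two_dvd_of_odd (hd : Odd d) (x : ZMod d) : 2 ∣ x := by
  have h : IsUnit (2 : ZMod d) := by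
    have := (ZMod.isUnit_iff_coprime 2 d).2 (Nat.coprime_two_left.2 hd)
    simpa using this
  exact h.dvd

theorem additive_of_altSum (hG : G.Connected) (hd : 0 < d) (f : G.edgeSet → ZMod d)
    (heven : ∀ (v : V) (c : G.Walk v v), Even c.length → altSum f c = 0)
    (hodd : Even d → HasOddCycle G → ∃ (v : V) (c : G.Walk v v), Odd c.length ∧
      ((d / 2 : ℕ) : ZMod d) * altSum f c = 0) :
    Additive f := by
  by_cases hex : HasOddCycle G
  · obtain ⟨r, c, hc, h2⟩ : ∃ (r : V) (c : G.Walk r r), Odd c.length ∧ 2 ∣ altSum f c := by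
      rcases Nat.even_or_odd d with hde | hdo
      · obtain ⟨r, c, hc, h⟩ := hodd hde hex
        exact ⟨r, c, hc, two_dvd_of_half_mul_eq_zero hd hde _ h⟩
      · obtain ⟨r, c, hc⟩ := hex
        exact ⟨r, c, hc, two_dvd_of_odd hdo _⟩
    obtain ⟨a, ha⟩ := h2
    refine exists_vertex_labeling hG f r a (heven r) fun c' hc' => ?_
    have h := heven r (c.append c') (by
      rw [SimpleGraph.Walk.length_append]; exact hc.add_odd hc')
    rw [altSum_append, hc.neg_one_pow] at h
    linear_combination ha - h
  -- Without odd closed walks the root value is free; `0` is chosen.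
  · obtain ⟨r⟩ := hG.nonempty
    exact exists_vertex_labeling hG f r 0 (heven r) fun c hc => (hex ⟨r, c, hc⟩).elim

theorem evenCycleProperty_iff (f : G.edgeSet → ZMod d) : EvenCycleProperty f ↔
    ∀ (v : V) (c : G.Walk v v), Even c.length → altSum f c = 0 := by
  refine forall₃_congr fun v c _ => ?_
  rw [← sum_pow_mul_edgeAt, ← sub_eq_zero]
  refine Eq.congr_left ?_
  rw [← sum_filter_add_sum_filter_not univ (fun i : Fin c.length => Odd (i.val + 1)),
    sub_eq_add_neg, ← sum_neg_distrib]
  simp only [Nat.not_odd_iff_even]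
  congr 1
  · refine sum_congr rfl fun i hi => ?_
    have h : Even i.val := by simpa [Nat.odd_add_one] using (mem_filter.1 hi).2
    rw [h.neg_one_pow, one_mul]
  · refine sum_congr rfl fun i hi => ?_
    have h : Odd i.val := by simpa [Nat.even_add_one] using (mem_filter.1 hi).2
    rw [h.neg_one_pow, neg_one_mul]

theorem compatible_iff (f : G.edgeSet → ZMod d) : Compatible f ↔
    (∀ (v : V) (c : G.Walk v v), Even c.length → altSum f c = 0) ∧
    (Even d → ∀ (v : V) (c : G.Walk v v), Odd c.length →
      ((d / 2 : ℕ) : ZMod d) * walkSum f c = 0) := by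
  have ho : OddCycleProperty f ↔ ∀ (v : V) (c : G.Walk v v), Odd c.length →
      ((d / 2 : ℕ) : ZMod d) * walkSum f c = 0 := by
    simp only [OddCycleProperty, sum_edgeAt]
  rw [Compatible, ← Nat.not_even_iff_odd, evenCycleProperty_iff, ho]
  tauto

theorem incidence_apply [DecidableEq V] [DecidableRel G.Adj] (x u v : V) (h : G.Adj u v) :
    incidence G x ⟨s(u, v), h⟩ =
      Pi.single (M := fun _ => ℤ) u 1 x + Pi.single (M := fun _ => ℤ) v 1 x := by
  have hne := h.ne
  simp only [incidence, Matrix.submatrix_apply, id, SimpleGraph.incMatrix_apply',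
    SimpleGraph.mk'_mem_incidenceSet_iff, h, true_and, Pi.single_apply]
  by_cases hu : x = u <;> by_cases hv : x = v <;> simp_all

theorem pairing_proj_eq_zero_of_span [Fintype G.edgeSet] {f : G.edgeSet → ZMod d} {S : Set (G.edgeSet → ℤ)}
    (hS : ∀ ω ∈ S, pairing (proj d ω) f = 0) {ω : G.edgeSet → ℤ}
    (hω : ω ∈ Submodule.span ℤ S) : pairing (proj d ω) f = 0 := by
  induction hω using Submodule.span_induction with
  | mem x hx => exact hS x hx
  | zero => simp [pairing, proj]
  | add x y _ _ hx hy =>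
    have : pairing (proj d (x + y)) f = pairing (proj d x) f + pairing (proj d y) f := by
      simp [pairing, proj, add_mul, sum_add_distrib]
    rw [this, hx, hy, add_zero]
  | smul a x _ hx =>
    have : pairing (proj d (a • x)) f = a * pairing (proj d x) f := by
      simp [pairing, proj, mul_sum, mul_assoc]
    rw [this, hx, mul_zero]

/-! ### Cycle vectors in the kernels -/

variable [Fintype V] [DecidableEq V] [DecidableRel G.Adj]

/-- Each row of the incidence matrix is itself an additive labeling, from the indicator of its
vertex, so its alternating sum telescopes to zero. -/
theorem omega_mem_kerInt {v : V} {c : G.Walk v v} (hc : Even c.length) :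
    omega d c ∈ kerInt (incidence G) := by
  rw [kerInt, LinearMap.mem_ker]
  ext x
  have h := sum_omega_mul_of_even d hc (incidence G x)
  rw [altSum_of_additive (incidence_apply x · · ·), hc.neg_one_pow, one_mul, sub_self] at h
  simpa [Matrix.mulVec, dotProduct, mul_comm] using h

theorem proj_mem_kerMod {ω : G.edgeSet → ℤ} (hω : ω ∈ kerInt (incidence G)) :
    proj d ω ∈ kerMod d (incidence G) := by
  rw [kerInt, LinearMap.mem_ker] at hω
  rw [kerMod, LinearMap.mem_ker]
  ext x
  have h := congrArg (Int.cast : ℤ → ZMod d) (congrFun hω x)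
  simpa [Matrix.mulVec, dotProduct, proj] using h

/-- On an odd closed walk a row's alternating sum telescopes to twice its value at the base point,
which `d/2` kills modulo `d`. -/
theorem proj_omega_mem_kerMod (hd : Even d) {v : V} {c : G.Walk v v} (hc : Odd c.length) :
    proj d (omega d c) ∈ kerMod d (incidence G) := by
  rw [kerMod, LinearMap.mem_ker]
  ext x
  have hadd : ∀ (u v : V) (h : G.Adj u v), (fun e => (incidence G x e : ZMod d)) ⟨s(u, v), h⟩ =
      (Pi.single (M := fun _ => ℤ) u 1 x : ℤ) + (Pi.single (M := fun _ => ℤ) v 1 x : ℤ) :=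
    fun u v h => by simp only [incidence_apply]; push_cast; rfl
  have h := sum_omega_mul_of_odd d hc (fun e => (incidence G x e : ZMod d))
  rw [← half_mul_altSum hd,
    altSum_of_additive (g := fun u => ((Pi.single (M := fun _ => ℤ) u 1 x : ℤ) : ZMod d)) hadd,
    hc.neg_one_pow, neg_one_mul, sub_neg_eq_add, ← two_mul, ← mul_assoc, half_mul_two hd,
    zero_mul] at h
  simpa [Matrix.mulVec, dotProduct, proj, mul_comm] using h

theorem pairing_eq_zero_of_additive {f : G.edgeSet → ZMod d} (hf : Additive f)
    {ω : G.edgeSet → ZMod d} (hω : ω ∈ kerMod d (incidence G)) : pairing ω f = 0 := by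
  obtain ⟨g, hg⟩ := hf
  rw [kerMod, LinearMap.mem_ker] at hω
  have hfg : f = Matrix.vecMul g ((incidence G).map (fun a : ℤ => (a : ZMod d))) := by
    ext ⟨e, he⟩
    induction e using Sym2.ind with
    | _ u v =>
      rw [hg u v he]
      simp only [Matrix.vecMul, dotProduct, Matrix.map_apply, incidence_apply _ u v he]
      simp [Pi.single_apply, mul_add, sum_add_distrib]
  have : pairing ω f = dotProduct f ω := by simp [pairing, dotProduct, mul_comm]
  rw [this, hfg, ← Matrix.dotProduct_mulVec]
  rw [Matrix.mulVecLin_apply] at hω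
  rw [hω, dotProduct_zero]

end Pairing

end ELabel

/-- Fourth and fifth items: the test on a finite generating set of the integer kernel, together
with one odd cycle when `d` is even and `G` has an odd cycle, for some and for every choice of the
generating set and of the odd cycle. -/
theorem theorem5p4 {V : Type*} [Fintype V] [DecidableEq V] (G : SimpleGraph V)
    [DecidableRel G.Adj] (hG : G.Connected) (d : ℕ) (hd : 0 < d) (f : G.edgeSet → ZMod d) :
    List.TFAE [
      ELabel.Compatible f,
      ∀ (v : V) (c : G.Walk v v), (Even c.length ∨ Even d) →
        ELabel.pairing (ELabel.proj d (ELabel.omega d c)) f = 0,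
      ∀ ω ∈ ELabel.kerMod d (ELabel.incidence G), ELabel.pairing ω f = 0,
      ∃ S : Finset (G.edgeSet → ℤ),
        Submodule.span ℤ (S : Set (G.edgeSet → ℤ)) = ELabel.kerInt (ELabel.incidence G) ∧
        (∀ ω ∈ S, ELabel.pairing (ELabel.proj d ω) f = 0) ∧
        (Even d → ELabel.HasOddCycle G → ∃ (v : V) (c : G.Walk v v), Odd c.length ∧
          ELabel.pairing (ELabel.proj d (ELabel.omega d c)) f = 0),
      ∀ S : Finset (G.edgeSet → ℤ),
        Submodule.span ℤ (S : Set (G.edgeSet → ℤ)) = ELabel.kerInt (ELabel.incidence G) →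
        (∀ ω ∈ S, ELabel.pairing (ELabel.proj d ω) f = 0) ∧
        (Even d → ∀ (v : V) (c : G.Walk v v), Odd c.length →
          ELabel.pairing (ELabel.proj d (ELabel.omega d c)) f = 0),
      ELabel.Additive f] := by
  have heven : ∀ (v : V) (c : G.Walk v v), Even c.length →
      ELabel.pairing (ELabel.proj d (ELabel.omega d c)) f = ELabel.altSum f c :=
    fun v c hc => ELabel.sum_omega_mul_of_even d hc f
  have hodd : ∀ (v : V) (c : G.Walk v v), Odd c.length →
      ELabel.pairing (ELabel.proj d (ELabel.omega d c)) f =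
        ((d / 2 : ℕ) : ZMod d) * ELabel.walkSum f c :=
    fun v c hc => ELabel.sum_omega_mul_of_odd d hc f
  tfae_have 1 → 6 := by
    rw [ELabel.compatible_iff]
    rintro ⟨he, ho⟩
    refine ELabel.additive_of_altSum hG hd f he fun hde ⟨v, c, hc⟩ => ⟨v, c, hc, ?_⟩
    rw [ELabel.half_mul_altSum hde, ho hde v c hc]
  tfae_have 6 → 3 := fun h ω hω => ELabel.pairing_eq_zero_of_additive h hω
  tfae_have 3 → 2 := by
    intro h v c hc
    rcases Nat.even_or_odd c.length with hce | hco
    · exact h _ (ELabel.proj_mem_kerMod (ELabel.omega_mem_kerInt hce))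
    · exact h _ (ELabel.proj_omega_mem_kerMod
        (hc.resolve_left (Nat.not_even_iff_odd.2 hco)) hco)
  tfae_have 2 → 1 := by
    intro h
    rw [ELabel.compatible_iff]
    exact ⟨fun v c hc => (heven v c hc).symm.trans (h v c (.inl hc)),
      fun hde v c hc => (hodd v c hc).symm.trans (h v c (.inr hde))⟩
  tfae_have 3 → 5 := by
    intro h S hS
    exact ⟨fun ω hω => h _ (ELabel.proj_mem_kerMod (hS ▸ Submodule.subset_span hω)),
      fun hde v c hc => h _ (ELabel.proj_omega_mem_kerMod hde hc)⟩
  tfae_have 5 → 4 := by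
    intro h
    obtain ⟨S, hS⟩ := IsNoetherian.noetherian (ELabel.kerInt (ELabel.incidence G))
    exact ⟨S, hS, (h S hS).1, fun hde ⟨v, c, hc⟩ => ⟨v, c, hc, (h S hS).2 hde v c hc⟩⟩
  tfae_have 4 → 6 := by
    rintro ⟨S, hS, hS0, ho⟩
    refine ELabel.additive_of_altSum hG hd f (fun v c hc => ?_) fun hde hex => ?_
    · rw [← heven v c hc]
      exact ELabel.pairing_proj_eq_zero_of_span hS0 (hS ▸ ELabel.omega_mem_kerInt hc)
    · obtain ⟨v, c, hc, h⟩ := ho hde hex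
      exact ⟨v, c, hc, by rw [ELabel.half_mul_altSum hde, ← hodd v c hc, h]⟩
  tfae_finish
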